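/- Let $q>2$ be a prime power, let $\mathcal Q=\mathsf Q^-(5,q)$ be an elliptic quadric of $\mathrm{PG}(5,q)$ with associated polarity $\perp$, and let $H$ be a hyperplane meeting $\mathcal Q$ in a parabolic quadric $\mathsf Q(4,q)$. Let $X=\mathcal Q\setminus H$. For $p\in X$ let $p^\sigma$ be the unique second point of $\mathcal Q$ on the line joining $p$ and $H^\perp$; it lies in $X$, and $p,p^\sigma$ are called conjugate. Write $u\sim v$ if $u\neq v$ and $v\in u^\perp$. Define relations on $X$ by: $(u,v)\in R_0$ iff $u=v$; $(u,v)\in R_1$ iff $v\not\sim u\sim v^\sigma$; $(u,v)\in R_2$ iff $u\ne v$, $u\neq v^\sigma$ and $v\not\sim u\not\sim v^\sigma$; $(u,v)\in R_3$ iff $v\sim u\not\sim v^\sigma$; $(u,v)\in R_4$ iff $u=v^\sigma$. Let $A_j$ be the adjacency matrix of $R_j$, and for $0\le i\le 4$ let $V_i=\{v\in\mathbb R^X : A_jv=P_{ij}v \text{ for } 0\le j\le 4\}$, where $$P=\begin{pmatrix}1&(q-1)(q^2+1)&(q-2)q(q^2+1)&(q-1)(q^2+1)&1\\1&q^2+1&0&-(q^2+1)&-1\\1&q-1&-2q&q-1&1\\1&-(q-1)&0&q-1&-1\\1&-(q-1)^2&2(q-2)q&-(q-1)^2&1\end{pmatrix}.$$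 Let $Y$ be a nonempty proper subset of $X$ with characteristic vector $\chi_Y$. Then $\chi_Y\in V_0\oplus V_2\oplus V_3$ if and only if $Y$ is an intriguing set of the graph $(X,R_3)$ for the eigenvalue $q-1$; that is, there are integers $h_1,h_2\ge 0$ such that every vertex of $Y$ is adjacent to exactly $h_1$ and every vertex of $X\setminus Y$ to exactly $h_2$ vertices of $Y$, and $\chi_Y$ lies in the sum of the span of the all-ones vector and the eigenspace of $A_3$ for $q-1$. Suppose that this is the case. Then: 1. $\chi_Y\in V_0\oplus V_2$ if and only if $Y^\sigma=Y$; 2. $\chi_Y\in V_0\oplus V_3$ if and only if $|Y\cap\{p,p^\sigma\}|=1$ for every $p\in X$. -/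

import Mathlib

open scoped LinearAlgebra.Projectivization

/-- The quadratic form `Q` on `K^6` defines an elliptic quadric `Q^-(5,q)` of `PG(5,q)`: in suitable
coordinates it is `f(x₀,x₁) + x₂x₃ + x₄x₅` with `f` a binary quadratic form without nontrivial
zeros (equivalently, `f` is irreducible). -/
def IsElliptic {K : Type*} [Field K] (Q : QuadraticForm K (Fin 6 → K)) : Prop :=
  ∃ (b : Module.Basis (Fin 6) K (Fin 6 → K)) (α β γ : K),
    (∀ x y : K, α * x ^ 2 + β * (x * y) + γ * y ^ 2 = 0 → x = 0 ∧ y = 0) ∧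
    ∀ v, Q v = α * b.repr v 0 ^ 2 + β * (b.repr v 0 * b.repr v 1) + γ * b.repr v 1 ^ 2
      + b.repr v 2 * b.repr v 3 + b.repr v 4 * b.repr v 5

/-- An elliptic quadric of `PG(5,q)` (given by a quadratic form `Q` on `K^6`), together with a
hyperplane `H` that meets it in a parabolic quadric `Q(4,q)`, that is, in a nonsingular quadric
of `H ≅ PG(4,q)`. -/
structure PWConfig (K : Type*) [Field K] where
  Q : QuadraticForm K (Fin 6 → K)
  elliptic : IsElliptic Q
  H : Submodule K (Fin 6 → K)
  finrank_H : Module.finrank K H = 5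
  parabolic : ∀ v ∈ H, Q v = 0 → (∀ w ∈ H, QuadraticMap.polar Q v w = 0) → v = 0

namespace PWConfig

section Geometry

variable {K : Type*} [Field K] (S : PWConfig K)

/-- The image of a subspace under the polarity `⊥` associated with the quadric. -/
def perp (W : Submodule K (Fin 6 → K)) : Submodule K (Fin 6 → K) :=
  W.orthogonalBilin S.Q.polarBilin

/-- The set `X` of the points of the quadric that are not in `H`. -/
def X : Type _ :=
  {p : ℙ K (Fin 6 → K) // (∀ v ∈ p.submodule, S.Q v = 0) ∧ ¬ p.submodule ≤ S.H}

variable {S}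

/-- Collinearity of points of the quadric. -/
def Coll (u v : S.X) : Prop := u ≠ v ∧ v.1.submodule ≤ S.perp u.1.submodule

lemma mem_perp {W : Submodule K (Fin 6 → K)} {v : Fin 6 → K} :
    v ∈ S.perp W ↔ ∀ w ∈ W, QuadraticMap.polar S.Q w v = 0 := Iff.rfl

instance [Finite K] : Finite S.X := by
  have : Finite (ℙ K (Fin 6 → K)) := Quotient.finite _
  exact Subtype.finite

noncomputable instance [Finite K] : Fintype S.X := Fintype.ofFinite _

end Geometry

section Conjugation

variable {K : Type*} [Field K] [Finite K] {S : PWConfig K}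

lemma polar_nondeg {v : Fin 6 → K} (h : ∀ w, QuadraticMap.polar S.Q v w = 0) : v = 0 := by
  obtain ⟨b, α, β, γ, hf, hQ⟩ := S.elliptic
  have key : ∀ i, QuadraticMap.polar S.Q v (b i) = 0 := fun i => h _
  have h0 := key 0
  have h1 := key 1
  have h2 := key 2
  have h3 := key 3
  have h4 := key 4
  have h5 := key 5
  simp only [QuadraticMap.polar, hQ, map_add, Finsupp.add_apply, Module.Basis.repr_self] at h0 h1 h2 h3 h4 h5
  simp at h0 h1 h2 h3 h4 h5
  have h2' : b.repr v 3 = 0 := by linear_combination h2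
  have h3' : b.repr v 2 = 0 := by linear_combination h3
  have h4' : b.repr v 5 = 0 := by linear_combination h4
  have h5' : b.repr v 4 = 0 := by linear_combination h5
  have e0 : 2 * α * b.repr v 0 + β * b.repr v 1 = 0 := by linear_combination h0
  have e1 : β * b.repr v 0 + 2 * γ * b.repr v 1 = 0 := by linear_combination h1
  have h01 : b.repr v 0 = 0 ∧ b.repr v 1 = 0 := by
    by_cases c2 : (2 : K) = 0
    · by_cases hβ : β = 0
      · exfalso
        have hα : α ≠ 0 := by
          rintro rfl
          have := (hf 1 0 (by ring)).1
          exact one_ne_zero this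
        have : CharP K 2 := CharTwo.of_one_ne_zero_of_two_eq_zero one_ne_zero c2
        have hr : ringChar K = 2 := ringChar.eq_iff.2 inferInstance
        obtain ⟨r, hr⟩ := FiniteField.isSquare_of_char_two hr (γ / α)
        have : γ = α * (r * r) := by rw [← hr]; field_simp
        have := (hf r 1 (by rw [this, hβ]; linear_combination α * r * r * c2)).2
        exact one_ne_zero this
      · rw [c2] at e0 e1
        simp [hβ] at e0 e1
        exact ⟨e1, e0⟩
    · apply hf
      have : (2 : K) * (α * b.repr v 0 ^ 2 + β * (b.repr v 0 * b.repr v 1)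
          + γ * b.repr v 1 ^ 2) = 0 := by
        linear_combination b.repr v 0 * e0 + b.repr v 1 * e1
      exact (mul_eq_zero.1 this).resolve_left c2
  apply b.repr.map_eq_zero_iff.1
  ext i
  fin_cases i
  · exact h01.1
  · exact h01.2
  · exact h3'
  · exact h2'
  · exact h5'
  · exact h4'

/-- `H^⊥` is a point off the quadric, and `H` is its image under the polarity. -/
lemma exists_centre (S : PWConfig K) : ∃ n : Fin 6 → K, S.perp S.H = Submodule.span K {n} ∧
    S.Q n ≠ 0 ∧ ∀ v, v ∈ S.H ↔ QuadraticMap.polar S.Q v n = 0 := by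
  have hrefl : (S.Q.polarBilin : LinearMap.BilinForm K (Fin 6 → K)).IsRefl := by
    intro x y h
    rw [QuadraticMap.polarBilin_apply_apply] at h ⊢
    rw [QuadraticMap.polar_comm]; exact h
  have hnd : (S.Q.polarBilin : LinearMap.BilinForm K (Fin 6 → K)).Nondegenerate :=
    hrefl.nondegenerate_iff_separatingLeft.2 fun v h => polar_nondeg h
  have hfr := LinearMap.BilinForm.finrank_orthogonal hnd S.H
  have hoo := LinearMap.BilinForm.orthogonal_orthogonal hnd hrefl S.H
  change Module.finrank K (S.perp S.H) = _ at hfr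
  rw [S.finrank_H, Module.finrank_fin_fun] at hfr
  obtain ⟨n, hn0, hn⟩ := finrank_eq_one_iff'.1 hfr
  have hspan : S.perp S.H = Submodule.span K {(n : Fin 6 → K)} := by
    apply le_antisymm
    · intro w hw
      obtain ⟨c, hc⟩ := hn ⟨w, hw⟩
      exact Submodule.mem_span_singleton.2 ⟨c, congrArg Subtype.val hc⟩
    · rw [Submodule.span_singleton_le_iff_mem]; exact n.2
  have hH : ∀ v, v ∈ S.H ↔ QuadraticMap.polar S.Q v n = 0 := by
    intro v
    constructor
    · intro hv
      exact mem_perp.1 n.2 v hv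
    · intro hv
      rw [← hoo]
      intro w hw
      change w ∈ S.perp S.H at hw
      rw [hspan] at hw
      obtain ⟨c, rfl⟩ := Submodule.mem_span_singleton.1 hw
      change QuadraticMap.polar S.Q _ _ = 0
      rw [QuadraticMap.polar_smul_left, QuadraticMap.polar_comm, hv, smul_zero]
  refine ⟨n, hspan, ?_, hH⟩
  intro hQ
  apply hn0
  apply Subtype.ext
  apply S.parabolic _ _ hQ
  · intro w hw
    rw [QuadraticMap.polar_comm]
    exact (hH w).1 hw
  · rw [hH, QuadraticMap.polar_self, hQ, smul_zero]

/-- The line joining `H^⊥` and a point `p` of `X` contains exactly one further point of the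
quadric, and that point is in `X`. -/
lemma existsUnique_conj (p : S.X) :
    ∃! p' : S.X, p' ≠ p ∧ p'.1.submodule ≤ p.1.submodule ⊔ S.perp S.H := by
  obtain ⟨n, hn, hQn, hH⟩ := S.exists_centre
  obtain ⟨p, hp, hpH⟩ := p
  induction p using Projectivization.ind with
  | h v hv =>
  rw [Projectivization.submodule_mk] at hp hpH
  rw [Submodule.span_singleton_le_iff_mem, hH] at hpH
  have hQv : S.Q v = 0 := hp v (Submodule.mem_span_singleton_self v)
  set B := QuadraticMap.polar S.Q v n with hB
  have hQab : ∀ a b : K, S.Q (a • v + b • n) = a * b * B + b * b * S.Q n := by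
    intro a b
    rw [QuadraticMap.map_add S.Q, QuadraticMap.map_smul, QuadraticMap.map_smul,
      QuadraticMap.polar_smul_left, QuadraticMap.polar_smul_right, hQv]
    simp only [smul_eq_mul]
    ring
  have hBab : ∀ a b : K, QuadraticMap.polar S.Q (a • v + b • n) n = a * B + 2 * b * S.Q n := by
    intro a b
    rw [QuadraticMap.polar_add_left, QuadraticMap.polar_smul_left, QuadraticMap.polar_smul_left,
      QuadraticMap.polar_self]
    simp only [smul_eq_mul]
    ring
  have hmk : ∀ (w : Fin 6 → K) (hw : w ≠ 0), S.Q w = 0 → QuadraticMap.polar S.Q w n ≠ 0 →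
      (∀ x ∈ (Projectivization.mk K w hw).submodule, S.Q x = 0) ∧
        ¬ (Projectivization.mk K w hw).submodule ≤ S.H := by
    intro w hw h1 h2
    rw [Projectivization.submodule_mk, Submodule.span_singleton_le_iff_mem, hH]
    refine ⟨fun x hx => ?_, h2⟩
    obtain ⟨c, rfl⟩ := Submodule.mem_span_singleton.1 hx
    rw [QuadraticMap.map_smul, h1, smul_zero]
  set c : K := -(B / S.Q n) with hc
  have hcQ : c * S.Q n = -B := by rw [hc]; field_simp
  have hc0 : c ≠ 0 := by
    rw [hc]; exact neg_ne_zero.2 (div_ne_zero hpH hQn)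
  set w : Fin 6 → K := (1 : K) • v + c • n with hw
  have hBw : QuadraticMap.polar S.Q w n ≠ 0 := by
    rw [hw, hBab]
    intro h
    apply hpH
    linear_combination 2 * hcQ - h
  have hw0 : w ≠ 0 := by
    intro h
    rw [h, QuadraticMap.polar_zero_left] at hBw
    exact hBw rfl
  have hQw : S.Q w = 0 := by
    rw [hw, hQab]
    linear_combination c * hcQ
  refine ⟨⟨Projectivization.mk K w hw0, hmk w hw0 hQw hBw⟩, ⟨?_, ?_⟩, ?_⟩
  · intro h
    have h' := congrArg Subtype.val h
    simp only [Projectivization.mk_eq_mk_iff'] at h'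
    obtain ⟨a, ha⟩ := h'
    have h1 : c • n = (a - 1) • v := by
      rw [sub_smul, ha, hw]; abel
    have h2 : S.Q (c • n) = 0 := by
      rw [h1, QuadraticMap.map_smul, hQv, smul_zero]
    rw [QuadraticMap.map_smul, smul_eq_mul] at h2
    exact mul_ne_zero (mul_ne_zero hc0 hc0) hQn h2
  · simp only [Projectivization.submodule_mk, hn]
    rw [Submodule.span_singleton_le_iff_mem]
    exact Submodule.add_mem_sup
      (Submodule.smul_mem _ _ (Submodule.mem_span_singleton_self v))
      (Submodule.smul_mem _ _ (Submodule.mem_span_singleton_self n))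
  · rintro ⟨r, hr, hrH⟩ ⟨hne, hle⟩
    apply Subtype.ext
    induction r using Projectivization.ind with
    | h x hx =>
    simp only [Projectivization.submodule_mk, hn] at hle hr
    rw [Submodule.span_singleton_le_iff_mem] at hle
    obtain ⟨y, hy, z, hz, hyz⟩ := Submodule.mem_sup.1 hle
    obtain ⟨a, rfl⟩ := Submodule.mem_span_singleton.1 hy
    obtain ⟨d, rfl⟩ := Submodule.mem_span_singleton.1 hz
    have hQx := hr x (Submodule.mem_span_singleton_self x)
    rw [← hyz, hQab] at hQx
    have hd : d ≠ 0 := by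
      rintro rfl
      apply hne
      apply Subtype.ext
      simp only [Projectivization.mk_eq_mk_iff']
      exact ⟨a, by rw [← hyz, zero_smul, add_zero]⟩
    have hda : a * B + d * S.Q n = 0 := by
      apply (mul_eq_zero.1 (_ : d * (a * B + d * S.Q n) = 0)).resolve_left hd
      linear_combination hQx
    have hdc : d = a * c := by
      apply mul_right_cancel₀ hQn
      linear_combination hda - a * hcQ
    simp only [Projectivization.mk_eq_mk_iff']
    refine ⟨a, ?_⟩
    rw [← hyz, hw, hdc, smul_add, smul_smul, smul_smul, mul_one]

/-- The conjugation `σ : X → X`: the image of `p` is the second point of the quadric on the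
line joining `p` and `H^⊥`. -/
noncomputable def conj (p : S.X) : S.X := (existsUnique_conj p).choose

lemma conj_spec (p : S.X) :
    conj p ≠ p ∧ (conj p).1.submodule ≤ p.1.submodule ⊔ S.perp S.H :=
  (existsUnique_conj p).choose_spec.1

/-- The relations `R₀, …, R₄` of the Penttila–Williford scheme. -/
def Rel : Fin 5 → S.X → S.X → Prop
  | 0, u, v => u = v
  | 1, u, v => ¬ Coll v u ∧ Coll u (conj v)
  | 2, u, v => u ≠ v ∧ u ≠ conj v ∧ ¬ Coll v u ∧ ¬ Coll u (conj v)
  | 3, u, v => Coll v u ∧ ¬ Coll u (conj v)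
  | 4, u, v => u = conj v

end Conjugation

end PWConfig

/-- The characteristic vector of a set. -/
noncomputable def charVec {X : Type*} (Y : Set X) : X → ℝ := Y.indicator 1

open Classical in
/-- The real adjacency matrix of a relation. -/
noncomputable def adjMat {X : Type*} (r : X → X → Prop) : Matrix X X ℝ :=
  Matrix.of fun x y => if r x y then 1 else 0

open Classical in
/-- The eigenspace of the adjacency matrix of `r` for the number `θ`. -/
noncomputable def adjEigenspace {X : Type*} [Fintype X] (r : X → X → Prop) (θ : ℝ) :
    Submodule ℝ (X → ℝ) :=
  Module.End.eigenspace (Matrix.toLin' (adjMat r)) θ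

/-- `Y` is a (nonempty, proper) intriguing set of the regular graph `(X, r)` for the
eigenvalue `θ`: there are `h₁, h₂` such that every vertex of `Y` has exactly `h₁` neighbours in
`Y` and every other vertex has exactly `h₂` neighbours in `Y`, and the characteristic vector of
`Y` lies in the sum of the span of the all-ones vector and the eigenspace for `θ`. -/
def IsIntriguingFor {X : Type*} [Fintype X] (r : X → X → Prop) (θ : ℝ) (Y : Set X) : Prop :=
  Y.Nonempty ∧ Y ≠ Set.univ ∧
  (∃ h₁ h₂ : ℕ, (∀ x ∈ Y, {y ∈ Y | r x y}.ncard = h₁) ∧ ∀ x ∉ Y, {y ∈ Y | r x y}.ncard = h₂) ∧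
  charVec Y ∈ Submodule.span ℝ {(1 : X → ℝ)} ⊔ adjEigenspace r θ

/-- The matrix of eigenvalues `P` of the Penttila–Williford scheme. -/
def pwEigenvalues (q : ℝ) : Matrix (Fin 5) (Fin 5) ℝ :=
  !![1, (q - 1) * (q ^ 2 + 1), (q - 2) * q * (q ^ 2 + 1), (q - 1) * (q ^ 2 + 1), 1;
     1, q ^ 2 + 1, 0, -(q ^ 2 + 1), -1;
     1, q - 1, -(2 * q), q - 1, 1;
     1, -(q - 1), 0, q - 1, -1;
     1, -(q - 1) ^ 2, 2 * (q - 2) * q, -(q - 1) ^ 2, 1]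

/-- The common eigenspace `V_i` of the scheme: `A_j v = P_{ij} v` for all `j`. -/
noncomputable def PWConfig.V {K : Type*} [Field K] [Fintype K] (S : PWConfig K) (i : Fin 5) :
    Submodule ℝ (S.X → ℝ) :=
  ⨅ j : Fin 5, adjEigenspace (PWConfig.Rel (S := S) j) (pwEigenvalues (Fintype.card K) i j)

/-! Let σ denote conjugation, acting on functions by composition. It is an involution commuting with
A₃, and A₄ = σ, A₁ = A₃σ, A₂ = J - I - A₁ - A₃ - A₄. So the whole scheme is governed by A₃, σ and J.
The eigenspace of A₃ for q - 1 splits into its σ-even part V₂ and its σ-odd part V₃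
(`V_two_sup_V_three`), while V₀ consists of the constants (`V_zero`). Hence V₀ + V₂ + V₃ is the
space in the definition of an intriguing set, and the constants h₁, h₂ come from evaluating A₃χ.
Write χ = c·1 + v + w with v even and w odd. Then χσ = c·1 + v - w, so Y is σ-invariant exactly when
w = 0. Also χ + χσ = 2(c·1 + v). If v = 0 this is constant, and the constant must be 1 because Y is
nonempty and proper. Conversely, if it is 1, then v is a constant eigenvector for q - 1, hence 0.
The geometric input is the valency of A₃ and the size of X, both read off from
`fiberCount_polar_nrep`. Let n span H^⊥ and let B be the polar form; points of X correspond to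
singular vectors x with B(x,n) = 1, and counting them by their product with a fixed one reduces to
values of Q on the complement of a hyperbolic pair. -/

namespace PWConfig

/-! ### Points of X as normalized singular vectors, and conjugation in these terms. -/

section NormalizedRepresentatives

variable {K : Type*} [Field K] [Finite K] (S : PWConfig K)

/-- A vector spanning `H^⊥`. -/
noncomputable def centre : Fin 6 → K := S.exists_centre.choose

lemma perp_H : S.perp S.H = Submodule.span K {S.centre} := S.exists_centre.choose_spec.1

lemma Q_centre : S.Q S.centre ≠ 0 := S.exists_centre.choose_spec.2.1

lemma mem_H_iff (v : Fin 6 → K) : v ∈ S.H ↔ QuadraticMap.polar S.Q v S.centre = 0 :=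
  S.exists_centre.choose_spec.2.2 v

variable {S}

lemma exists_nrep (p : S.X) : ∃ x : Fin 6 → K, p.1.submodule = Submodule.span K {x} ∧
    QuadraticMap.polar S.Q x S.centre = 1 := by
  obtain ⟨p, hp, hpH⟩ := p
  induction p using Projectivization.ind with
  | h v hv =>
  rw [Projectivization.submodule_mk, Submodule.span_singleton_le_iff_mem, mem_H_iff] at hpH
  refine ⟨(QuadraticMap.polar S.Q v S.centre)⁻¹ • v, ?_, ?_⟩
  · simp only [Projectivization.submodule_mk]
    exact (Submodule.span_singleton_smul_eq (inv_ne_zero hpH).isUnit v).symm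
  · rw [QuadraticMap.polar_smul_left, smul_eq_mul, inv_mul_cancel₀ hpH]

/-- The representative of a point of `X` whose product with the centre is `1`. -/
noncomputable def nrep (p : S.X) : Fin 6 → K := (exists_nrep p).choose

lemma submodule_eq (p : S.X) : p.1.submodule = Submodule.span K {nrep p} :=
  (exists_nrep p).choose_spec.1

lemma polar_nrep_centre (p : S.X) : QuadraticMap.polar S.Q (nrep p) S.centre = 1 :=
  (exists_nrep p).choose_spec.2

lemma Q_nrep (p : S.X) : S.Q (nrep p) = 0 :=
  p.2.1 _ (by rw [submodule_eq]; exact Submodule.mem_span_singleton_self _)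

lemma nrep_injective : Function.Injective (nrep : S.X → Fin 6 → K) := by
  intro p r h
  apply Subtype.ext
  apply Projectivization.submodule_injective
  rw [submodule_eq, submodule_eq, h]

/-- With `nrep_injective`, this turns counting points of X into counting vectors. -/
lemma exists_nrep_eq {x : Fin 6 → K} (hx : S.Q x = 0)
    (h1 : QuadraticMap.polar S.Q x S.centre = 1) : ∃ p : S.X, nrep p = x := by
  have hx0 : x ≠ 0 := by
    rintro rfl
    simp at h1
  let p : S.X := ⟨Projectivization.mk K x hx0, by
    rw [Projectivization.submodule_mk, Submodule.span_singleton_le_iff_mem, mem_H_iff, h1]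
    refine ⟨fun y hy => ?_, one_ne_zero⟩
    obtain ⟨c, rfl⟩ := Submodule.mem_span_singleton.1 hy
    rw [QuadraticMap.map_smul, hx, smul_zero]⟩
  have hp : p.1.submodule = Submodule.span K {x} := Projectivization.submodule_mk ..
  refine ⟨p, ?_⟩
  have hmem : nrep p ∈ Submodule.span K {x} := by
    rw [← hp, submodule_eq]; exact Submodule.mem_span_singleton_self _
  obtain ⟨c, hc⟩ := Submodule.mem_span_singleton.1 hmem
  have := polar_nrep_centre p
  rw [← hc, QuadraticMap.polar_smul_left, h1, smul_eq_mul, mul_one] at this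
  rw [← hc, this, one_smul]

lemma nrep_conj (p : S.X) : nrep (conj p) = (S.Q S.centre)⁻¹ • S.centre - nrep p := by
  have hm := S.Q_centre
  obtain ⟨r, hr⟩ : ∃ r : S.X, nrep r = (S.Q S.centre)⁻¹ • S.centre - nrep p := by
    apply exists_nrep_eq
    · rw [sub_eq_add_neg, QuadraticMap.map_add S.Q, QuadraticMap.map_neg, QuadraticMap.map_smul,
        Q_nrep, QuadraticMap.polar_neg_right, QuadraticMap.polar_smul_left,
        QuadraticMap.polar_comm, polar_nrep_centre]
      simp only [smul_eq_mul]
      field_simp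
      ring
    · rw [sub_eq_add_neg, QuadraticMap.polar_add_left, QuadraticMap.polar_smul_left,
        QuadraticMap.polar_neg_left, QuadraticMap.polar_self, polar_nrep_centre]
      simp only [smul_eq_mul]
      field_simp
      ring
  have hrp : r ≠ p := by
    rintro rfl
    -- Applying Q to this identity gives 0 = 1/Q(n), in every characteristic.
    have h2 : (2 : K) • nrep r = (S.Q S.centre)⁻¹ • S.centre := by
      rw [two_smul]
      nth_rewrite 1 [hr]
      abel
    have h3 := congrArg S.Q h2
    rw [QuadraticMap.map_smul, QuadraticMap.map_smul, Q_nrep, smul_zero] at h3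
    simp [hm, eq_comm (a := (0 : K))] at h3
  have hle : r.1.submodule ≤ p.1.submodule ⊔ S.perp S.H := by
    rw [submodule_eq, submodule_eq, perp_H, Submodule.span_singleton_le_iff_mem, hr]
    exact Submodule.sub_mem _
      (Submodule.mem_sup_right (Submodule.smul_mem _ _ (Submodule.mem_span_singleton_self _)))
      (Submodule.mem_sup_left (Submodule.mem_span_singleton_self _))
  rw [(existsUnique_conj p).unique (conj_spec p) ⟨hrp, hle⟩, hr]

lemma conj_conj (p : S.X) : conj (conj p) = p := by
  apply nrep_injective
  rw [nrep_conj, nrep_conj, sub_sub_cancel]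

lemma coll_iff (u v : S.X) :
    Coll u v ↔ u ≠ v ∧ QuadraticMap.polar S.Q (nrep u) (nrep v) = 0 := by
  unfold Coll
  rw [submodule_eq, submodule_eq, Submodule.span_singleton_le_iff_mem, mem_perp]
  refine and_congr_right fun _ => ⟨fun h => h _ (Submodule.mem_span_singleton_self _), ?_⟩
  intro h w hw
  obtain ⟨c, rfl⟩ := Submodule.mem_span_singleton.1 hw
  rw [QuadraticMap.polar_smul_left, h, smul_zero]

lemma coll_comm {u v : S.X} : Coll u v ↔ Coll v u := by
  rw [coll_iff, coll_iff, ne_comm, QuadraticMap.polar_comm]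

/-- This makes the product of representatives decide the relation: 0 means R₀ or R₃, 1/Q(n) means R₁
or R₄, any other value means R₂. -/
lemma polar_nrep_conj (u v : S.X) : QuadraticMap.polar S.Q (nrep u) (nrep (conj v)) =
    (S.Q S.centre)⁻¹ - QuadraticMap.polar S.Q (nrep u) (nrep v) := by
  rw [nrep_conj, sub_eq_add_neg, QuadraticMap.polar_add_right, QuadraticMap.polar_smul_right,
    QuadraticMap.polar_neg_right, polar_nrep_centre, smul_eq_mul, mul_one, sub_eq_add_neg]

lemma coll_conj_conj {u v : S.X} : Coll (conj u) (conj v) ↔ Coll u v := by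
  rw [coll_iff, coll_iff, polar_nrep_conj, QuadraticMap.polar_comm, polar_nrep_conj,
    QuadraticMap.polar_comm, sub_sub_cancel,
    (Function.LeftInverse.injective (conj_conj (S := S))).ne_iff]

lemma polar_nrep_self (u : S.X) : QuadraticMap.polar S.Q (nrep u) (nrep u) = 0 := by
  rw [QuadraticMap.polar_self, Q_nrep, smul_zero]

lemma not_coll_conj_of_polar {u v : S.X} (h : QuadraticMap.polar S.Q (nrep u) (nrep v) = 0) :
    ¬ Coll u (conj v) := by
  rw [coll_iff, polar_nrep_conj, h, sub_zero]
  exact fun h' => inv_ne_zero S.Q_centre h'.2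

lemma rel_zero (u v : S.X) : Rel 0 u v ↔ u = v := Iff.rfl

lemma rel_four (u v : S.X) : Rel 4 u v ↔ conj u = v := by
  change u = conj v ↔ _
  constructor
  · rintro rfl; exact conj_conj v
  · rintro rfl; exact (conj_conj u).symm

/-- The second condition in the definition is redundant, since a product cannot be both 0 and
1/Q(n). -/
lemma rel_three (u v : S.X) : Rel 3 u v ↔ Coll u v := by
  change Coll v u ∧ _ ↔ _
  rw [coll_comm]
  exact ⟨And.left, fun h => ⟨h, not_coll_conj_of_polar ((coll_iff u v).1 h).2⟩⟩

lemma rel_one (u v : S.X) : Rel 1 u v ↔ Coll u (conj v) := by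
  change ¬ Coll v u ∧ _ ↔ _
  rw [coll_comm]
  exact ⟨And.right, fun h => ⟨fun h' => not_coll_conj_of_polar ((coll_iff u v).1 h').2 h, h⟩⟩

/-- The relations partition `X × X`. -/
lemma sum_rel_eq_one (u v : S.X) (f : S.X → ℝ) [∀ i, Decidable (Rel i u v)] :
    ∑ i : Fin 5, (if Rel i u v then f v else 0) = f v := by
  have h2 : Rel 2 u v ↔ ¬ Rel 0 u v ∧ ¬ Rel 4 u v ∧ ¬ Rel 3 u v ∧ ¬ Rel 1 u v := by
    rw [rel_three, rel_one, coll_comm (u := u) (v := v)]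
    exact Iff.rfl
  have h01 : Rel 0 u v → ¬ Rel 1 u v := by
    rw [rel_one]
    rintro rfl
    exact not_coll_conj_of_polar (polar_nrep_self u)
  have h03 : Rel 0 u v → ¬ Rel 3 u v := by
    rw [rel_three]
    exact fun h h' => h'.1 h
  have h04 : Rel 0 u v → ¬ Rel 4 u v := by
    rintro rfl h
    exact (conj_spec u).1 h.symm
  have h13 : Rel 3 u v → ¬ Rel 1 u v := by
    rw [rel_three, rel_one, coll_iff]
    exact fun h => not_coll_conj_of_polar h.2
  have h14 : Rel 4 u v → ¬ Rel 1 u v := by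
    rw [rel_one]
    exact fun h h' => h'.1 h
  have h34 : Rel 4 u v → ¬ Rel 3 u v := by
    rw [rel_three]
    rintro rfl h
    rw [← coll_conj_conj, conj_conj] at h
    exact not_coll_conj_of_polar (polar_nrep_self v) h
  simp only [Fin.sum_univ_five]
  by_cases c0 : Rel 0 u v
  · simp [c0, h2, h01 c0, h03 c0, h04 c0]
  by_cases c4 : Rel 4 u v
  · simp [c0, h2, c4, h14 c4, h34 c4]
  by_cases c3 : Rel 3 u v
  · simp [c0, h2, c4, c3, h13 c3]
  by_cases c1 : Rel 1 u v <;> simp [c0, h2, c4, c3, c1]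

end NormalizedRepresentatives

end PWConfig

/-! ### Value distributions and hyperbolic planes. -/

section FiberCount

open Classical in
/-- The number of points at which a function takes the value `c`. -/
noncomputable def fiberCount {W K : Type*} [Fintype W] (g : W → K) (c : K) : ℤ :=
  ∑ x, if g x = c then 1 else 0

lemma fiberCount_comp_equiv {W W' K : Type*} [Fintype W] [Fintype W'] (e : W' ≃ W) (g : W → K)
    (c : K) : fiberCount (g ∘ e) c = fiberCount g c := by
  classical
  exact e.sum_comp fun x => if g x = c then (1 : ℤ) else 0

lemma fiberCount_eq_card {W K : Type*} [Fintype W] (g : W → K) (c : K) :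
    fiberCount g c = Nat.card {x // g x = c} := by
  classical
  simp [fiberCount, Nat.card_eq_fintype_card, Fintype.card_subtype]

lemma sum_fiberCount {W K : Type*} [Fintype W] [Fintype K] (g : W → K) :
    ∑ c, fiberCount g c = Fintype.card W := by
  classical
  unfold fiberCount
  rw [Finset.sum_comm]
  simp

variable {K : Type*} [Field K] [Fintype K]

open Classical in
lemma fiberCount_mul (d : K) : fiberCount (fun t : K × K => t.1 * t.2) d =
    Fintype.card K - 1 + if d = 0 then (Fintype.card K : ℤ) else 0 := by
  have h : ∀ a : K, (∑ b : K, if a * b = d then (1 : ℤ) else 0) =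
      1 + if a = 0 then (if d = 0 then (Fintype.card K : ℤ) else 0) - 1 else 0 := by
    intro a
    by_cases ha : a = 0
    · subst ha
      by_cases hd : d = 0
      · simp [hd]
      · simp [hd, eq_comm (a := (0 : K))]
    · have : ∀ b, a * b = d ↔ b = d / a := fun b => by
        rw [eq_div_iff ha, mul_comm]
      simp [this, ha]
  unfold fiberCount
  rw [Fintype.sum_prod_type]
  simp only [h, Finset.sum_add_distrib]
  simp
  ring

/-- Each w admits q - 1 pairs with the required product, and q more when that product is 0. The
coefficient q is nonzero, so the formula can also be used backwards, to cancel a hyperbolic plane.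
-/
lemma fiberCount_hyperbolic {W : Type*} [Fintype W] {f : (K × K) × W → K} {g : W → K}
    (hf : ∀ t, f t = t.1.1 * t.1.2 + g t.2) (c : K) : fiberCount f c =
      Fintype.card K * fiberCount g c + (Fintype.card K - 1) * Fintype.card W := by
  classical
  have h : ∀ w : W, (∑ t : K × K, if t.1 * t.2 + g w = c then (1 : ℤ) else 0) =
      Fintype.card K - 1 + Fintype.card K * if g w = c then 1 else 0 := by
    intro w
    have := fiberCount_mul (c - g w)
    unfold fiberCount at this
    simp only [eq_sub_iff_add_eq, sub_eq_zero, eq_comm (a := c)] at this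
    rw [this]
    split_ifs <;> simp
  unfold fiberCount
  rw [Fintype.sum_prod_type_right]
  simp only [hf, h, Finset.sum_add_distrib, ← Finset.mul_sum]
  simp
  ring

end FiberCount

/-! ### Anisotropic binary forms. -/

section BinaryForms

variable {K : Type*} [Field K]

/-- The binary quadratic form with given coefficients. -/
def binaryForm (α β γ : K) (t : K × K) : K := α * t.1 ^ 2 + β * (t.1 * t.2) + γ * t.2 ^ 2

variable {α β γ : K}

lemma leading_ne_zero (hf : ∀ t, binaryForm α β γ t = 0 → t = 0) : α ≠ 0 := by
  rintro rfl
  have := hf (1, 0) (by simp [binaryForm])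
  simp at this

/-- The norm form of an anisotropic binary form over a finite field is universal. -/
lemma exists_normForm_eq [Fintype K] (hf : ∀ t, binaryForm α β γ t = 0 → t = 0) (e : K) :
    ∃ s t : K, s ^ 2 + β * (s * t) + α * γ * t ^ 2 = e := by
  have hα := leading_ne_zero hf
  by_cases h2 : (2 : K) = 0
  · have : CharP K 2 := CharTwo.of_one_ne_zero_of_two_eq_zero one_ne_zero h2
    obtain ⟨r, hr⟩ := FiniteField.isSquare_of_char_two (ringChar.eq_iff.2 inferInstance) e
    exact ⟨r, 0, by rw [hr]; ring⟩
  · have hodd : Fintype.card K % 2 = 1 := FiniteField.odd_card_of_char_ne_two fun h => by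
      have : CharP K 2 := ringChar.of_eq h
      exact h2 (CharTwo.two_eq_zero)
    obtain ⟨h, rfl⟩ : ∃ h, β = 2 * h := ⟨β / 2, by field_simp⟩
    have hδ : α * γ - h ^ 2 ≠ 0 := by
      intro h0
      -- The form takes the value α(αγ - h²) at (-h, α).
      have := hf (-h, α) (by
        simp only [binaryForm]
        linear_combination α * h0)
      simp [hα] at this
    -- Completing the square, the norm form is (s + ht)² + (αγ - h²)t².
    obtain ⟨a, b, hab⟩ := FiniteField.exists_root_sum_quadratic
      (f := Polynomial.X ^ 2 - Polynomial.C e)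
      (g := Polynomial.C (α * γ - h ^ 2) * Polynomial.X ^ 2)
      (Polynomial.degree_X_pow_sub_C (by norm_num) e) (Polynomial.degree_C_mul_X_pow 2 hδ) hodd
    refine ⟨a - h * b, b, ?_⟩
    simp only [Polynomial.eval_sub, Polynomial.eval_pow, Polynomial.eval_X, Polynomial.eval_C,
      Polynomial.eval_mul] at hab
    linear_combination hab

/-- Multiplication by an element s + tω with ω² = βω - αγ scales the form by its norm s² + βst +
αγt². Choosing norm d/c sends the fiber over c into the fiber over d, injectively by anisotropy. -/
lemma card_fiber_binary_le [Fintype K] (hf : ∀ t, binaryForm α β γ t = 0 → t = 0) {c d : K}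
    (hc : c ≠ 0) (hd : d ≠ 0) :
    fiberCount (binaryForm α β γ) c ≤ fiberCount (binaryForm α β γ) d := by
  obtain ⟨s, t, hst⟩ := exists_normForm_eq hf (d / c)
  have hN : d / c ≠ 0 := div_ne_zero hd hc
  have key : ∀ x y : K, binaryForm α β γ (s * x - γ * t * y, s * y + α * t * x + β * t * y) =
      d / c * binaryForm α β γ (x, y) := by
    intro x y
    rw [← hst]
    simp only [binaryForm]
    ring
  rw [fiberCount_eq_card, fiberCount_eq_card, Nat.cast_le]
  apply Nat.card_le_card_of_injective (fun z : {z // binaryForm α β γ z = c} =>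
    (⟨(s * z.1.1 - γ * t * z.1.2, s * z.1.2 + α * t * z.1.1 + β * t * z.1.2), by
      rw [key, z.2, div_mul_cancel₀ _ hc]⟩ : {z // binaryForm α β γ z = d}))
  rintro ⟨⟨x, y⟩, hz⟩ ⟨⟨x', y'⟩, hz'⟩ h
  simp only [Subtype.mk.injEq, Prod.mk.injEq] at h
  obtain ⟨h1, h2⟩ := h
  have h0 := key (x - x') (y - y')
  rw [show s * (x - x') - γ * t * (y - y') = 0 by linear_combination h1,
    show s * (y - y') + α * t * (x - x') + β * t * (y - y') = 0 by linear_combination h2] at h0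
  have := hf (x - x', y - y') (by
    apply (mul_eq_zero.1 _).resolve_left hN
    rw [← h0]
    simp [binaryForm])
  simp only [Prod.mk_eq_zero, sub_eq_zero] at this
  simp [this]

open Classical in
-- Zero is taken once, and the q - 1 nonzero values share the other q² - 1 vectors equally.
lemma fiberCount_binary [Fintype K] (hf : ∀ t, binaryForm α β γ t = 0 → t = 0) (c : K) :
    fiberCount (binaryForm α β γ) c =
      Fintype.card K + 1 - Fintype.card K * if c = 0 then 1 else 0 := by
  have h0 : fiberCount (binaryForm α β γ) 0 = 1 := by
    have : ∀ t, binaryForm α β γ t = 0 ↔ t = 0 :=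
      fun t => ⟨hf t, by rintro rfl; simp [binaryForm]⟩
    simp [fiberCount, this]
  by_cases hc : c = 0
  · subst hc; rw [h0]; simp
  have hsum := sum_fiberCount (binaryForm α β γ)
  have hall : ∀ d, fiberCount (binaryForm α β γ) d = fiberCount (binaryForm α β γ) c +
      if d = 0 then 1 - fiberCount (binaryForm α β γ) c else 0 := by
    intro d
    by_cases hd : d = 0
    · simp [hd, h0]
    · simp [hd, le_antisymm (card_fiber_binary_le hf hd hc) (card_fiber_binary_le hf hc hd)]
  rw [Finset.sum_congr rfl fun d _ => hall d, Finset.sum_add_distrib] at hsum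
  simp only [Finset.sum_const, Finset.card_univ, nsmul_eq_mul, Finset.sum_ite_eq',
    Finset.mem_univ, if_true, Fintype.card_prod, Nat.cast_mul] at hsum
  have hq : (1 : ℤ) < Fintype.card K := by exact_mod_cast Fintype.one_lt_card
  simp only [hc, if_false, mul_zero, sub_zero]
  have h1 : ((Fintype.card K : ℤ) - 1) *
      (fiberCount (binaryForm α β γ) c - (Fintype.card K + 1)) = 0 := by
    linear_combination hsum
  have := (mul_eq_zero.1 h1).resolve_left (by omega)
  omega

end BinaryForms

/-! ### Value distribution of the elliptic form. -/

section EllipticForms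

variable {K : Type*} [Field K] [Fintype K]

open Classical in
lemma IsElliptic.fiberCount_eq {Q : QuadraticForm K (Fin 6 → K)} (hQ : IsElliptic Q) (c : K) :
    fiberCount Q c = (Fintype.card K : ℤ) ^ 5 + Fintype.card K ^ 2
      - Fintype.card K ^ 3 * if c = 0 then 1 else 0 := by
  obtain ⟨b, α, β, γ, hf, hQ⟩ := hQ
  have hf' : ∀ t, binaryForm α β γ t = 0 → t = 0 := fun t ht => Prod.ext_iff.2 (hf t.1 t.2 ht)
  let e₁ : (Fin 6 → K) ≃ (K × K) × (K × K) × (K × K) :=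
    { toFun := fun x => ((x 4, x 5), (x 2, x 3), (x 0, x 1))
      invFun := fun t => ![t.2.2.1, t.2.2.2, t.2.1.1, t.2.1.2, t.1.1, t.1.2]
      left_inv := fun x => by ext i; fin_cases i <;> rfl
      right_inv := fun t => rfl }
  let e : (Fin 6 → K) ≃ (K × K) × (K × K) × (K × K) := b.equivFun.toEquiv.trans e₁
  have hQe : ∀ t, Q (e.symm t) = t.1.1 * t.1.2 +
      (fun t : (K × K) × (K × K) => t.1.1 * t.1.2 + binaryForm α β γ t.2) t.2 := by
    intro t
    obtain ⟨v, rfl⟩ := e.surjective t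
    rw [e.symm_apply_apply, hQ]
    change _ = b.repr v 4 * b.repr v 5 + (b.repr v 2 * b.repr v 3 + (α * b.repr v 0 ^ 2 +
      β * (b.repr v 0 * b.repr v 1) + γ * b.repr v 1 ^ 2))
    ring
  rw [← fiberCount_comp_equiv e.symm, fiberCount_hyperbolic (f := Q ∘ e.symm)
      (g := fun t : (K × K) × (K × K) => t.1.1 * t.1.2 + binaryForm α β γ t.2) hQe,
    fiberCount_hyperbolic (fun _ => rfl), fiberCount_binary hf']
  simp only [Fintype.card_prod, Nat.cast_mul]
  ring

end EllipticForms

/-! ### The complement of a hyperbolic pair. -/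

section HyperbolicPairs

variable {K M : Type*} [Field K] [AddCommGroup M] [Module K M] {Q : QuadraticForm K M} {u v : M}

/-- Splitting off a hyperbolic pair. -/
def hyperbolicSplitting (hu : Q u = 0) (hv : Q v = 0) (huv : QuadraticMap.polar Q u v = 1) :
    (K × K) × {w : M // QuadraticMap.polar Q w u = 0 ∧ QuadraticMap.polar Q w v = 0} ≃ M where
  toFun t := t.1.1 • u + t.1.2 • v + t.2
  invFun x := ((QuadraticMap.polar Q x v, QuadraticMap.polar Q x u),
    ⟨x - QuadraticMap.polar Q x v • u - QuadraticMap.polar Q x u • v, by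
      simp only [QuadraticMap.polar_sub_left, QuadraticMap.polar_smul_left,
        QuadraticMap.polar_self, hu, hv, huv, QuadraticMap.polar_comm Q v u, smul_eq_mul]
      constructor <;> simp⟩)
  left_inv := by
    rintro ⟨⟨a, b⟩, w, hwu, hwv⟩
    have h1 : QuadraticMap.polar Q (a • u + b • v + w) v = a := by
      simp [QuadraticMap.polar_add_left, QuadraticMap.polar_smul_left, hv, huv, hwv]
    have h2 : QuadraticMap.polar Q (a • u + b • v + w) u = b := by
      simp [QuadraticMap.polar_add_left, QuadraticMap.polar_smul_left, hu,
        QuadraticMap.polar_comm Q v u, huv, hwu]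
    simp only [h1, h2, Prod.mk.injEq, Subtype.mk.injEq, true_and]
    abel
  right_inv x := by
    simp only
    abel

lemma Q_hyperbolicSplitting (hu : Q u = 0) (hv : Q v = 0) (huv : QuadraticMap.polar Q u v = 1) (t) :
    Q (hyperbolicSplitting hu hv huv t) = t.1.1 * t.1.2 + Q t.2 := by
  obtain ⟨⟨a, b⟩, w, hwu, hwv⟩ := t
  simp [hyperbolicSplitting, QuadraticMap.map_add Q, QuadraticMap.map_smul,
    QuadraticMap.polar_smul_left, QuadraticMap.polar_smul_right, hu, hv,
    huv, QuadraticMap.polar_comm Q _ w, hwu, hwv, mul_comm]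

variable [Fintype K]

open Classical in
-- Cancelling the plane at the level of counts replaces Witt cancellation.
lemma fiberCount_perp_pair {Q : QuadraticForm K (Fin 6 → K)} (hQ : IsElliptic Q)
    {u v : Fin 6 → K} (hu : Q u = 0) (hv : Q v = 0) (huv : QuadraticMap.polar Q u v = 1)
    [Fintype {w // QuadraticMap.polar Q w u = 0 ∧ QuadraticMap.polar Q w v = 0}] (c : K) :
    fiberCount (fun w : {w // QuadraticMap.polar Q w u = 0 ∧ QuadraticMap.polar Q w v = 0} =>
      Q w) c = (Fintype.card K : ℤ) ^ 3 + Fintype.card K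
        - Fintype.card K ^ 2 * if c = 0 then 1 else 0 := by
  have hq : (Fintype.card K : ℤ) ≠ 0 := by exact_mod_cast Fintype.card_ne_zero
  let e := hyperbolicSplitting hu hv huv
  have hcard := Fintype.card_congr e
  simp only [Fintype.card_prod, Fintype.card_fun, Fintype.card_fin] at hcard
  have hcard' : (Fintype.card K : ℤ) ^ 2 * (Fintype.card
      {w // QuadraticMap.polar Q w u = 0 ∧ QuadraticMap.polar Q w v = 0} - Fintype.card K ^ 4)
      = 0 := by
    have : (Fintype.card K : ℤ) * Fintype.card K * Fintype.card
      {w // QuadraticMap.polar Q w u = 0 ∧ QuadraticMap.polar Q w v = 0} = Fintype.card K ^ 6 := by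
      exact_mod_cast hcard
    linear_combination this
  have hW := (mul_eq_zero.1 hcard').resolve_left (pow_ne_zero 2 hq)
  have h1 := fiberCount_comp_equiv e Q c
  rw [hQ.fiberCount_eq, fiberCount_hyperbolic (Q_hyperbolicSplitting hu hv huv)
    (g := fun w : {w // _} => Q w)] at h1
  apply mul_left_cancel₀ hq
  linear_combination h1 - (Fintype.card K - 1) * hW

end HyperbolicPairs

namespace PWConfig

/-! ### The size of X and the valency of A₃. -/

section Valencies

variable {K : Type*} [Field K] [Fintype K] {S : PWConfig K}

open Classical in
-- With m = Q(n), the vectors x and n - mx form a hyperbolic pair. For y = a·x + b'·(n - mx) + w one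
-- has B(y,x) = b' and B(y,n) = a + mb'. So the conditions on y force b' = b and a = 1 - mb, and
-- Q(y) = 0 becomes Q(w) = b(mb - 1).
lemma fiberCount_polar_nrep (u : S.X) (b : K) :
    fiberCount (fun p : S.X => QuadraticMap.polar S.Q (nrep p) (nrep u)) b =
      (Fintype.card K : ℤ) ^ 3 + Fintype.card K -
        Fintype.card K ^ 2 * if b * (S.Q S.centre * b - 1) = 0 then 1 else 0 := by
  set n := S.centre with hn
  set m := S.Q n with hm
  set x := nrep u with hx
  have hxn : QuadraticMap.polar S.Q x n = 1 := polar_nrep_centre u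
  have hQx : S.Q x = 0 := Q_nrep u
  have hQv : S.Q (n - m • x) = 0 := by
    rw [sub_eq_add_neg, QuadraticMap.map_add S.Q, QuadraticMap.map_neg, QuadraticMap.map_smul,
      QuadraticMap.polar_neg_right, QuadraticMap.polar_smul_right, QuadraticMap.polar_comm, hxn,
      hQx]
    simp [hm]
  have hxv : QuadraticMap.polar S.Q x (n - m • x) = 1 := by
    rw [QuadraticMap.polar_sub_right, QuadraticMap.polar_smul_right, hxn, polar_nrep_self]
    simp
  let e := hyperbolicSplitting hQx hQv hxv
  have he1 : ∀ t, QuadraticMap.polar S.Q (e t) x = t.1.2 := fun t =>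
    congrArg (fun s => s.1.2) (e.symm_apply_apply t)
  have he2 : ∀ t, QuadraticMap.polar S.Q (e t) n = t.1.1 + m * t.1.2 := fun t => by
    have h1 : QuadraticMap.polar S.Q (e t) (n - m • x) = t.1.1 :=
      congrArg (fun s => s.1.1) (e.symm_apply_apply t)
    rw [QuadraticMap.polar_sub_right, QuadraticMap.polar_smul_right, he1, smul_eq_mul] at h1
    linear_combination h1
  have heQ := Q_hyperbolicSplitting hQx hQv hxv
  rw [← fiberCount_perp_pair S.elliptic hQx hQv hxv, fiberCount_eq_card, fiberCount_eq_card,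
    Nat.cast_inj]
  have hex : ∀ w : {w : {w // QuadraticMap.polar S.Q w x = 0 ∧
      QuadraticMap.polar S.Q w (n - m • x) = 0} // S.Q w = b * (m * b - 1)},
      ∃ p : S.X, nrep p = e ((1 - m * b, b), w.1) := by
    intro w
    apply exists_nrep_eq
    · rw [heQ, w.2]; ring
    · rw [he2]; ring
  choose f hf using hex
  symm
  apply Nat.card_congr
  refine Equiv.ofBijective (fun w => ⟨f w, by rw [hf, he1]⟩) ⟨?_, ?_⟩
  · intro w w' h
    have h1 := congrArg (fun p => nrep p.1) h
    simp only [hf, e.apply_eq_iff_eq, Prod.mk.injEq, true_and] at h1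
    exact Subtype.ext h1
  · rintro ⟨p, hp⟩
    obtain ⟨⟨⟨a, b'⟩, w⟩, ht⟩ := e.surjective (nrep p)
    have h1 := he1 ((a, b'), w)
    have h2 := he2 ((a, b'), w)
    have h3 := heQ ((a, b'), w)
    change S.Q (e _) = _ at h3
    rw [ht] at h1 h2 h3
    rw [hp] at h1
    rw [polar_nrep_centre] at h2
    rw [Q_nrep] at h3
    simp only at h1 h2 h3
    subst h1
    have ha : a = 1 - m * b := by linear_combination -h2
    subst ha
    refine ⟨⟨w, by linear_combination -h3⟩, ?_⟩
    apply Subtype.ext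
    apply nrep_injective
    rw [hf, ht]

/-- Summing over all b, the correction q² occurs twice, at b = 0 and b = 1/Q(n). -/
lemma card_X (u : S.X) :
    (Fintype.card S.X : ℤ) = (Fintype.card K : ℤ) ^ 4 - Fintype.card K ^ 2 := by
  classical
  rw [← sum_fiberCount (fun p : S.X => QuadraticMap.polar S.Q (nrep p) (nrep u))]
  have h : ∀ b : K, b * (S.Q S.centre * b - 1) = 0 ↔ b = 0 ∨ b = (S.Q S.centre)⁻¹ := by
    intro b
    rw [mul_eq_zero, sub_eq_zero, mul_comm, mul_eq_one_iff_eq_inv₀ S.Q_centre]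
  have h2 : (Finset.univ.filter fun b : K => b = 0 ∨ b = (S.Q S.centre)⁻¹).card = 2 := by
    rw [show (Finset.univ.filter fun b : K => b = 0 ∨ b = (S.Q S.centre)⁻¹) =
      {0, (S.Q S.centre)⁻¹} by ext; simp]
    exact Finset.card_pair (inv_ne_zero S.Q_centre).symm
  simp only [fiberCount_polar_nrep, h, Finset.sum_sub_distrib, ← Finset.mul_sum, Finset.sum_boole,
    h2]
  simp
  ring

open Classical in
lemma sum_coll (u : S.X) : (∑ p : S.X, if Coll u p then (1 : ℝ) else 0) =
    ((Fintype.card K : ℝ) - 1) * (Fintype.card K ^ 2 + 1) := by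
  have h := fiberCount_polar_nrep u 0
  -- The point u is orthogonal to itself but not collinear with itself, so the fiber over 0 has one
  -- point too many.
  have h1 : ∀ p : S.X, (if QuadraticMap.polar S.Q (nrep p) (nrep u) = 0 then (1 : ℤ) else 0) =
      (if Coll u p then 1 else 0) + if p = u then 1 else 0 := by
    intro p
    rw [coll_comm, coll_iff]
    by_cases hp : p = u
    · subst hp; simp [Q_nrep]
    · simp [hp]
  unfold fiberCount at h
  simp only [h1, Finset.sum_add_distrib, Finset.sum_ite_eq', Finset.mem_univ, zero_mul,
    if_true] at h
  have h3 : (∑ p : S.X, if Coll u p then (1 : ℤ) else 0) =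
    ((Fintype.card K : ℤ) - 1) * (Fintype.card K ^ 2 + 1) := by linear_combination h
  exact_mod_cast congrArg (Int.cast : ℤ → ℝ) h3

end Valencies

end PWConfig

/-! ### Characteristic vectors and adjacency operators. -/

lemma charVec_of_mem {X : Type*} {Y : Set X} {x : X} (h : x ∈ Y) : charVec Y x = 1 := by
  simp [charVec, h]

lemma charVec_of_notMem {X : Type*} {Y : Set X} {x : X} (h : x ∉ Y) : charVec Y x = 0 := by
  simp [charVec, h]

section AdjacencyOperators

variable {X : Type*} [Fintype X]

lemma mem_adjEigenspace {r : X → X → Prop} {θ : ℝ} {v : X → ℝ} :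
    v ∈ adjEigenspace r θ ↔ (adjMat r).mulVec v = θ • v := by
  classical
  unfold adjEigenspace
  rw [Module.End.mem_eigenspace_iff, Matrix.toLin'_apply]

open Classical in
lemma adjMat_mulVec (r : X → X → Prop) (v : X → ℝ) (x : X) :
    (adjMat r).mulVec v x = ∑ y, if r x y then v y else 0 := by
  simp [adjMat, Matrix.mulVec, dotProduct]

lemma adjMat_mulVec_charVec (r : X → X → Prop) (Y : Set X) (x : X) :
    (adjMat r).mulVec (charVec Y) x = ({y ∈ Y | r x y}.ncard : ℝ) := by
  classical
  rw [adjMat_mulVec, Set.ncard_eq_toFinset_card']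
  simp only [charVec, Set.indicator_apply, Pi.one_apply, ← ite_and]
  rw [Finset.sum_boole]
  congr 2
  ext y
  simp [and_comm]

end AdjacencyOperators

namespace PWConfig

/-! ### The spaces V₀, V₂, V₃ in terms of A₃ and conjugation. -/

section Eigenspaces

variable {K : Type*} [Field K] [Fintype K] {S : PWConfig K}

lemma mem_V {i : Fin 5} {v : S.X → ℝ} :
    v ∈ S.V i ↔ ∀ j, (adjMat (Rel (S := S) j)).mulVec v =
      pwEigenvalues (Fintype.card K) i j • v := by
  simp only [V, Submodule.mem_iInf, mem_adjEigenspace]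

lemma mulVec_rel_zero (v : S.X → ℝ) : (adjMat (Rel (S := S) 0)).mulVec v = v := by
  classical
  ext x
  simp [adjMat_mulVec, rel_zero]

lemma mulVec_rel_four (v : S.X → ℝ) : (adjMat (Rel (S := S) 4)).mulVec v = v ∘ conj := by
  classical
  ext x
  simp [adjMat_mulVec, rel_four]

/-- Conjugation as a permutation of `X`. -/
noncomputable def conjEquiv : S.X ≃ S.X := ⟨conj, conj, conj_conj, conj_conj⟩

lemma mulVec_rel_three_comp_conj (v : S.X → ℝ) :
    (adjMat (Rel (S := S) 3)).mulVec (v ∘ conj) =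
      (adjMat (Rel (S := S) 3)).mulVec v ∘ conj := by
  classical
  ext x
  simp only [adjMat_mulVec, rel_three, Function.comp]
  rw [← (conjEquiv (S := S)).sum_comp]
  refine Finset.sum_congr rfl fun y _ => ?_
  change (if Coll x (conj y) then v (conj (conj y)) else 0) = _
  rw [conj_conj, ← coll_conj_conj, conj_conj]

lemma mulVec_rel_one (v : S.X → ℝ) :
    (adjMat (Rel (S := S) 1)).mulVec v = (adjMat (Rel (S := S) 3)).mulVec (v ∘ conj) := by
  classical
  ext x
  simp only [adjMat_mulVec, rel_three, rel_one, Function.comp]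
  rw [← (conjEquiv (S := S)).sum_comp]
  refine Finset.sum_congr rfl fun y _ => ?_
  change (if Coll x (conj (conj y)) then v (conj y) else 0) = _
  rw [conj_conj]

lemma mulVec_rel_two (v : S.X → ℝ) : (adjMat (Rel (S := S) 2)).mulVec v =
    (∑ y, v y) • (1 : S.X → ℝ) - (v + v ∘ conj +
      (adjMat (Rel (S := S) 3)).mulVec v + (adjMat (Rel (S := S) 3)).mulVec (v ∘ conj)) := by
  classical
  ext x
  have h : ∑ i : Fin 5, (adjMat (Rel (S := S) i)).mulVec v x = ∑ y, v y := by
    simp only [adjMat_mulVec]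
    rw [Finset.sum_comm]
    exact Finset.sum_congr rfl fun y _ => sum_rel_eq_one x y v
  rw [Fin.sum_univ_five, mulVec_rel_zero, mulVec_rel_one, mulVec_rel_four] at h
  simp only [Pi.sub_apply, Pi.add_apply, Pi.smul_apply, Pi.one_apply, smul_eq_mul, mul_one]
  linear_combination h

lemma mulVec_rel_three_const (c : ℝ) :
    (adjMat (Rel (S := S) 3)).mulVec (c • (1 : S.X → ℝ)) =
    (((Fintype.card K : ℝ) - 1) * (Fintype.card K ^ 2 + 1)) • c • (1 : S.X → ℝ) := by
  classical
  rw [Matrix.mulVec_smul, smul_comm]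
  congr 1
  ext x
  rw [adjMat_mulVec]
  simp only [rel_three, Pi.one_apply, Pi.smul_apply, smul_eq_mul, mul_one]
  exact sum_coll x

lemma const_comp_conj (c : ℝ) : (c • (1 : S.X → ℝ)) ∘ conj = c • 1 := rfl

lemma const_mem_V_zero (u : S.X) (c : ℝ) : c • (1 : S.X → ℝ) ∈ S.V 0 := by
  rw [mem_V]
  have hX : (Fintype.card S.X : ℝ) = (Fintype.card K : ℝ) ^ 4 - Fintype.card K ^ 2 := by
    exact_mod_cast congrArg (Int.cast : ℤ → ℝ) (card_X u)
  intro j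
  fin_cases j
  · simp [mulVec_rel_zero, pwEigenvalues]
  · simp only [Fin.mk_one, mulVec_rel_one, const_comp_conj, mulVec_rel_three_const]
    simp [pwEigenvalues]
  · simp only [Fin.reduceFinMk, mulVec_rel_two, const_comp_conj, mulVec_rel_three_const]
    ext x
    simp [pwEigenvalues, hX]
    ring
  · simp only [Fin.reduceFinMk, mulVec_rel_three_const]
    simp [pwEigenvalues]
  · simp [mulVec_rel_four, pwEigenvalues, const_comp_conj]

/-- The A_j sum to J and row 0 of P sums to q⁴ - q², so (q⁴ - q²)v = (∑ v)·1. -/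
lemma exists_eq_const_of_mem_V_zero {v : S.X → ℝ} (hv : v ∈ S.V 0) :
    ∃ c : ℝ, v = c • 1 := by
  rw [mem_V] at hv
  have h1 := hv 1
  have h2 := hv 2
  have h3 := hv 3
  have h4 := hv 4
  rw [mulVec_rel_one] at h1
  rw [mulVec_rel_two, h1, h3, ← mulVec_rel_four, h4] at h2
  have hq : (1 : ℝ) < Fintype.card K := by exact_mod_cast Fintype.one_lt_card
  have hX : (Fintype.card K : ℝ) ^ 4 - Fintype.card K ^ 2 ≠ 0 :=
    (sub_pos.2 (pow_lt_pow_right₀ hq (by norm_num))).ne'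
  refine ⟨(∑ y, v y) / ((Fintype.card K : ℝ) ^ 4 - Fintype.card K ^ 2), ?_⟩
  ext x
  have := congrFun h2 x
  simp [pwEigenvalues] at this
  simp only [Pi.smul_apply, Pi.one_apply, smul_eq_mul, mul_one]
  rw [eq_div_iff hX]
  linear_combination -this

/-- A₃ has constant column sum (q - 1)(q² + 1), which exceeds q - 1 by (q - 1)q² ≠ 0. -/
lemma sum_eq_zero_of_eigenvector {v : S.X → ℝ}
    (hv : (adjMat (Rel (S := S) 3)).mulVec v = ((Fintype.card K : ℝ) - 1) • v) :
    ∑ x, v x = 0 := by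
  classical
  have h : ∑ x, (adjMat (Rel (S := S) 3)).mulVec v x =
      ((Fintype.card K : ℝ) - 1) * (Fintype.card K ^ 2 + 1) * ∑ x, v x := by
    simp only [adjMat_mulVec, rel_three]
    rw [Finset.sum_comm, Finset.mul_sum]
    refine Finset.sum_congr rfl fun y _ => ?_
    rw [← sum_coll y, Finset.sum_mul]
    refine Finset.sum_congr rfl fun x _ => ?_
    rw [coll_comm]
    split_ifs <;> simp
  rw [hv] at h
  simp only [Pi.smul_apply, smul_eq_mul, ← Finset.mul_sum] at h
  have hq : (1 : ℝ) < Fintype.card K := by exact_mod_cast Fintype.one_lt_card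
  have : ((Fintype.card K : ℝ) - 1) * Fintype.card K ^ 2 * ∑ x, v x = 0 := by
    linear_combination -h
  exact (mul_eq_zero.1 this).resolve_left
    (mul_ne_zero (by linarith) (pow_ne_zero 2 (by linarith)))

/-- The entries for A₃ and A₄ imply the rest: the J term vanishes on v, whence A₂v = -2v - 2(q - 1)v
= -2qv. -/
lemma mem_V_two {v : S.X → ℝ} :
    v ∈ S.V 2 ↔
      (adjMat (Rel (S := S) 3)).mulVec v = ((Fintype.card K : ℝ) - 1) • v ∧ v ∘ conj = v := by
  rw [mem_V]
  constructor
  · intro h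
    refine ⟨by simpa [pwEigenvalues] using h 3, ?_⟩
    rw [← mulVec_rel_four]
    simpa [pwEigenvalues] using h 4
  · rintro ⟨h, hc⟩ j
    fin_cases j
    · simp [mulVec_rel_zero, pwEigenvalues]
    · simp only [Fin.mk_one, mulVec_rel_one, hc, h]
      simp [pwEigenvalues]
    · simp only [Fin.reduceFinMk, mulVec_rel_two, hc, h, sum_eq_zero_of_eigenvector h]
      ext x
      simp [pwEigenvalues]
      ring
    · simp [pwEigenvalues, h]
    · simp [mulVec_rel_four, pwEigenvalues, hc]

lemma mem_V_three {v : S.X → ℝ} :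
    v ∈ S.V 3 ↔
      (adjMat (Rel (S := S) 3)).mulVec v = ((Fintype.card K : ℝ) - 1) • v ∧ v ∘ conj = -v := by
  rw [mem_V]
  constructor
  · intro h
    refine ⟨by simpa [pwEigenvalues] using h 3, ?_⟩
    rw [← mulVec_rel_four]
    simpa [pwEigenvalues] using h 4
  · rintro ⟨h, hc⟩ j
    fin_cases j
    · simp [mulVec_rel_zero, pwEigenvalues]
    · simp only [Fin.mk_one, mulVec_rel_one, hc, h, Matrix.mulVec_neg]
      ext x
      simp [pwEigenvalues]
      ring
    · simp only [Fin.reduceFinMk, mulVec_rel_two, hc, h, sum_eq_zero_of_eigenvector h,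
        Matrix.mulVec_neg]
      ext x
      simp [pwEigenvalues]
    · simp [pwEigenvalues, h]
    · simp [mulVec_rel_four, pwEigenvalues, hc]

/-- The eigenspace of `A₃` for `q - 1` is `V₂ ⊕ V₃`. -/
lemma V_two_sup_V_three :
    S.V 2 ⊔ S.V 3 = adjEigenspace (Rel (S := S) 3) ((Fintype.card K : ℝ) - 1) := by
  apply le_antisymm
  · apply sup_le
    · intro v hv
      exact mem_adjEigenspace.2 (mem_V_two.1 hv).1
    · intro v hv
      exact mem_adjEigenspace.2 (mem_V_three.1 hv).1
  · intro v hv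
    rw [mem_adjEigenspace] at hv
    have hvc : (adjMat (Rel (S := S) 3)).mulVec (v ∘ conj) =
        ((Fintype.card K : ℝ) - 1) • (v ∘ conj) := by
      rw [mulVec_rel_three_comp_conj, hv]; rfl
    -- The even and odd parts of v under conjugation.
    refine Submodule.mem_sup.2 ⟨(1 / 2 : ℝ) • (v + v ∘ conj), mem_V_two.2 ⟨?_, ?_⟩,
      (1 / 2 : ℝ) • (v - v ∘ conj), mem_V_three.2 ⟨?_, ?_⟩, ?_⟩
    · rw [Matrix.mulVec_smul, Matrix.mulVec_add, hv, hvc]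
      module
    · ext x
      simp [conj_conj]
      ring
    · rw [Matrix.mulVec_smul, Matrix.mulVec_sub, hv, hvc]
      module
    · ext x
      simp [conj_conj]
      ring
    · module

lemma V_zero (u : S.X) : S.V 0 = Submodule.span ℝ {(1 : S.X → ℝ)} := by
  ext v
  rw [Submodule.mem_span_singleton]
  constructor
  · intro hv
    obtain ⟨c, rfl⟩ := exists_eq_const_of_mem_V_zero hv
    exact ⟨c, rfl⟩
  · rintro ⟨c, rfl⟩
    exact const_mem_V_zero u c

lemma const_eq_zero_of_eigenvector {c : ℝ} (u : S.X)
    (h : (adjMat (Rel (S := S) 3)).mulVec (c • (1 : S.X → ℝ)) =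
      ((Fintype.card K : ℝ) - 1) • c • (1 : S.X → ℝ)) :
    c = 0 := by
  have h1 := sum_eq_zero_of_eigenvector h
  have : Nonempty S.X := ⟨u⟩
  simpa using h1

/-! ### Intriguing sets and the two criteria. -/

lemma charVec_comp_conj_iff {Y : Set S.X} : charVec Y ∘ conj = charVec Y ↔ conj '' Y = Y := by
  have h1 : conj '' Y = conj ⁻¹' Y :=
    congrFun (Set.image_eq_preimage_of_inverse conj_conj conj_conj) Y
  have h2 : charVec Y ∘ conj = charVec (conj ⁻¹' Y) := by
    rfl
  rw [h1, h2]
  exact ⟨fun h => Set.indicator_one_inj ℝ h, fun h => by rw [h]⟩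

lemma ncard_inter_pair (Y : Set S.X) (p : S.X) :
    ((Y ∩ {p, conj p}).ncard : ℝ) = charVec Y p + charVec Y (conj p) := by
  have hp : p ≠ conj p := (conj_spec p).1.symm
  by_cases h1 : p ∈ Y <;> by_cases h2 : conj p ∈ Y
  · rw [charVec_of_mem h1, charVec_of_mem h2,
      Set.inter_eq_right.2 (Set.insert_subset h1 (Set.singleton_subset_iff.2 h2)),
      Set.ncard_pair hp]
    norm_num
  · rw [charVec_of_mem h1, charVec_of_notMem h2, Set.inter_insert_of_mem h1,
      Set.inter_singleton_eq_empty.2 h2]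
    simp
  · rw [charVec_of_notMem h1, charVec_of_mem h2, Set.inter_insert_of_notMem h1,
      Set.inter_eq_right.2 (Set.singleton_subset_iff.2 h2)]
    simp
  · rw [charVec_of_notMem h1, charVec_of_notMem h2, Set.inter_insert_of_notMem h1,
      Set.inter_singleton_eq_empty.2 h2]
    simp

lemma isIntriguingFor_of_mem {Y : Set S.X} (hne : Y.Nonempty) (hproper : Y ≠ Set.univ)
    (h : charVec Y ∈ Submodule.span ℝ {(1 : S.X → ℝ)} ⊔
      adjEigenspace (Rel (S := S) 3) ((Fintype.card K : ℝ) - 1)) :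
    IsIntriguingFor (Rel (S := S) 3) ((Fintype.card K : ℝ) - 1) Y := by
  refine ⟨hne, hproper, ?_, h⟩
  obtain ⟨y, hy⟩ := hne
  obtain ⟨z, hz⟩ := (Set.ne_univ_iff_exists_notMem Y).1 hproper
  obtain ⟨a, ha, w, hw, hχ⟩ := Submodule.mem_sup.1 h
  obtain ⟨c, rfl⟩ := Submodule.mem_span_singleton.1 ha
  rw [mem_adjEigenspace] at hw
  -- Apply A₃ to χ = c·1 + w, with w = χ - c·1 an eigenvector: the count at x depends only on
  -- whether x lies in Y.
  have key : ∀ x, ({y ∈ Y | Rel 3 x y}.ncard : ℝ) =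
      ((Fintype.card K : ℝ) - 1) * Fintype.card K ^ 2 * c
        + ((Fintype.card K : ℝ) - 1) * charVec Y x := by
    intro x
    rw [← adjMat_mulVec_charVec, ← hχ, Matrix.mulVec_add, hw, mulVec_rel_three_const]
    simp
    ring
  refine ⟨{x ∈ Y | Rel 3 y x}.ncard, {x ∈ Y | Rel 3 z x}.ncard, fun x hx => ?_, fun x hx => ?_⟩
  · rw [← Nat.cast_inj (R := ℝ), key, key, charVec_of_mem hx, charVec_of_mem hy]
  · rw [← Nat.cast_inj (R := ℝ), key, key, charVec_of_notMem hx, charVec_of_notMem hz]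

lemma mem_V_zero_sup_V_two_iff {Y : Set S.X}
    (h : charVec Y ∈ S.V 0 ⊔ S.V 2 ⊔ S.V 3) :
    charVec Y ∈ S.V 0 ⊔ S.V 2 ↔ conj '' Y = Y := by
  rw [← charVec_comp_conj_iff]
  constructor
  · intro h'
    obtain ⟨a, ha, w, hw, hχ⟩ := Submodule.mem_sup.1 h'
    obtain ⟨c, rfl⟩ := exists_eq_const_of_mem_V_zero ha
    rw [← hχ]
    exact congrArg (c • (1 : S.X → ℝ) + ·) (mem_V_two.1 hw).2
  · intro hσ
    obtain ⟨b, hb, w, hw, hχ⟩ := Submodule.mem_sup.1 h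
    obtain ⟨a, ha, v, hv, rfl⟩ := Submodule.mem_sup.1 hb
    obtain ⟨c, rfl⟩ := exists_eq_const_of_mem_V_zero ha
    -- Invariance of χ and v makes w even as well as odd.
    have hw0 : w = 0 := by
      ext x
      have h1 := congrFun (mem_V_two.1 hv).2 x
      have h2 := congrFun (mem_V_three.1 hw).2 x
      have h3 := congrFun hσ x
      rw [← hχ] at h3
      simp at h1 h2 h3 ⊢
      linarith
    rw [hw0, add_zero] at hχ
    rwa [← hχ]

lemma mem_V_zero_sup_V_three_iff {Y : Set S.X} (hne : Y.Nonempty) (hproper : Y ≠ Set.univ)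
    (h : charVec Y ∈ S.V 0 ⊔ S.V 2 ⊔ S.V 3) :
    charVec Y ∈ S.V 0 ⊔ S.V 3 ↔ ∀ p : S.X, (Y ∩ {p, conj p}).ncard = 1 := by
  obtain ⟨u, hu⟩ := hne
  obtain ⟨z, hz⟩ := (Set.ne_univ_iff_exists_notMem Y).1 hproper
  have hn : ∀ p : S.X, (Y ∩ {p, conj p}).ncard = 1 ↔ charVec Y p + charVec Y (conj p) = 1 := by
    intro p
    rw [← ncard_inter_pair, Nat.cast_eq_one]
  simp only [hn]
  constructor
  · intro h'
    obtain ⟨a, ha, w, hw, hχ⟩ := Submodule.mem_sup.1 h'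
    obtain ⟨c, rfl⟩ := exists_eq_const_of_mem_V_zero ha
    have hs : ∀ p, charVec Y p + charVec Y (conj p) = 2 * c := by
      intro p
      have h1 := congrFun (mem_V_three.1 hw).2 p
      rw [← hχ]
      simp at h1 ⊢
      linarith
    have h1 := hs u
    have h2 := hs z
    rw [charVec_of_mem hu] at h1
    rw [charVec_of_notMem hz] at h2
    intro p
    rw [hs]
    -- The constant 2c is 1 or 2 at u ∈ Y and 0 or 1 at z ∉ Y, hence 1.
    by_cases h3 : conj u ∈ Y
    · rw [charVec_of_mem h3] at h1
      by_cases h4 : conj z ∈ Y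
      · rw [charVec_of_mem h4] at h2; linarith
      · rw [charVec_of_notMem h4] at h2; linarith
    · rw [charVec_of_notMem h3] at h1; linarith
  · intro hs
    obtain ⟨b, hb, w, hw, hχ⟩ := Submodule.mem_sup.1 h
    obtain ⟨a, ha, v, hv, rfl⟩ := Submodule.mem_sup.1 hb
    obtain ⟨c, rfl⟩ := exists_eq_const_of_mem_V_zero ha
    -- From χ + χσ = 1 the odd part cancels, leaving 2c + 2v = 1; so v is constant, and being an
    -- eigenvector for q - 1 it vanishes.
    have hvc : v = (1 / 2 - c) • (1 : S.X → ℝ) := by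
      ext x
      have h1 := congrFun (mem_V_two.1 hv).2 x
      have h2 := congrFun (mem_V_three.1 hw).2 x
      have h3 := hs x
      rw [← hχ] at h3
      simp at h1 h2 h3 ⊢
      linarith
    have hv3 := (mem_V_two.1 hv).1
    rw [hvc] at hv3
    rw [const_eq_zero_of_eigenvector u hv3, zero_smul] at hvc
    rw [hvc, add_zero] at hχ
    rw [← hχ]
    exact Submodule.add_mem_sup (const_mem_V_zero u c) hw

end Eigenspaces

end PWConfig

theorem mainTheorem6 {K : Type*} [Field K] [Fintype K] (hq : 2 < Fintype.card K)
    (S : PWConfig K) (Y : Set S.X) (hne : Y.Nonempty) (hproper : Y ≠ Set.univ) :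
    (charVec Y ∈ S.V 0 ⊔ S.V 2 ⊔ S.V 3 ↔
      IsIntriguingFor (PWConfig.Rel (S := S) 3) ((Fintype.card K : ℝ) - 1) Y) ∧
    (charVec Y ∈ S.V 0 ⊔ S.V 2 ⊔ S.V 3 →
      (charVec Y ∈ S.V 0 ⊔ S.V 2 ↔ PWConfig.conj '' Y = Y) ∧
      (charVec Y ∈ S.V 0 ⊔ S.V 3 ↔ ∀ p : S.X, (Y ∩ {p, PWConfig.conj p}).ncard = 1)) := by
  obtain ⟨u, hu⟩ := id hne
  refine ⟨?_, fun h => ⟨PWConfig.mem_V_zero_sup_V_two_iff h,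
    PWConfig.mem_V_zero_sup_V_three_iff hne hproper h⟩⟩
  rw [sup_assoc, PWConfig.V_two_sup_V_three, PWConfig.V_zero u]
  exact ⟨PWConfig.isIntriguingFor_of_mem hne hproper, fun h => h.2.2.2⟩
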